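/- Let $p>1$ be a real number and $n>1$ an integer, and let $$F_{p,n}(y)=\int_0^y\frac{dt}{(1-t^n)^{1/p}}$$ for $y\in[-1,1]$ if $n$ is even and for $y\in(-\infty,1]$ if $n$ is odd. Put $\pi_{p,n}=2F_{p,n}(1)$ and $p'=p/(p-1)$. The function $F_{p,n}$ is strictly increasing; let $\sin_{p,n}=F_{p,n}^{-1}$, a function on $D=[-\tfrac12\pi_{p,n},\tfrac12\pi_{p,n}]$ if $n$ is even and on $D=(\lim_{y\to-\infty}F_{p,n}(y),\tfrac12\pi_{p,n}]$ if $n$ is odd. For integers $m>1$ let $$\mu(m,n)=\int_1^\infty\frac{dt}{(t^n-1)^{(m-1)/m}},\qquad \nu(m,n)=\int_0^\infty\frac{dt}{(1+t^n)^{(m-1)/m}}.$$ Theorem. Suppose that $p'$ is an integer, and write $\mu=\mu(p',n)$, $\nu=\nu(p',n)$. Then $\sin_{p,n}$ extends to a real-analytic function on the following open interval $I\supseteq D$ (where the integrals $\mu$, $\nu$ that occur in the description of $I$ are finite): 1. if $p'$ and $n$ are both even, $I=\mathbb R$, and the extension is $2\pi_{p,n}$-periodic; 2. if $p'$ is even and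 $n$ is odd, $I=(-\nu,\ \pi_{p,n}+\nu)$; 3. if $p'$ is odd and $n$ is even, $I=(-\tfrac12\pi_{p,n}-\mu,\ \tfrac12\pi_{p,n}+\mu)$; 4. if $p'$ and $n$ are both odd, $I=(-\nu,\ \tfrac12\pi_{p,n}+\mu)$. Furthermore, in each case $I$ is the maximal interval on which $\sin_{p,n}$ is real-analytic: every interval $J$ that meets the interior of $D$ and carries a function that is real-analytic at each point of $J$ and agrees with $\sin_{p,n}$ on $J\cap D$ is contained in $I$. -/

import Mathlib

open Set MeasureTheory

noncomputable section

/-- `F_{p,n}(y) = ∫₀^y (1 - tⁿ)^{-1/p} dt`. -/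
def genF (p : ℝ) (n : ℕ) (y : ℝ) : ℝ :=
  ∫ t in (0 : ℝ)..y, 1 / (1 - t ^ n) ^ (1 / p)

/-- The set on which `F_{p,n}` is considered: `[-1, 1]` for `n` even, `(-∞, 1]` for `n` odd. -/
def genFDomain (n : ℕ) : Set ℝ :=
  {y | y ≤ 1 ∧ (Even n → -1 ≤ y)}

/-- `π_{p,n} = 2 F_{p,n}(1)`. -/
def genPi (p : ℝ) (n : ℕ) : ℝ := 2 * genF p n 1

/-- The domain of the generalized sine: the range of `F_{p,n}`, which is
`[-π_{p,n}/2, π_{p,n}/2]` for `n` even and `(F_{p,n}(-∞), π_{p,n}/2]` for `n` odd. -/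
def genSinDomain (p : ℝ) (n : ℕ) : Set ℝ := genF p n '' genFDomain n

/-- The generalized sine `sin_{p,n} = F_{p,n}⁻¹`; only its values on `genSinDomain p n` matter. -/
def genSin (p : ℝ) (n : ℕ) : ℝ → ℝ := Function.invFunOn (genF p n) (genFDomain n)

/-- The integrand of `μ(m,n)`. -/
def muIntegrand (m n : ℕ) (t : ℝ) : ℝ := 1 / (t ^ n - 1) ^ (((m : ℝ) - 1) / m)

/-- The integrand of `ν(m,n)`. -/
def nuIntegrand (m n : ℕ) (t : ℝ) : ℝ := 1 / (1 + t ^ n) ^ (((m : ℝ) - 1) / m)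

/-- `μ(m,n) = ∫₁^∞ (tⁿ - 1)^{-(m-1)/m} dt`. -/
def genMu (m n : ℕ) : ℝ := ∫ t in Ioi (1 : ℝ), muIntegrand m n t

/-- `ν(m,n) = ∫₀^∞ (1 + tⁿ)^{-(m-1)/m} dt`. -/
def genNu (m n : ℕ) : ℝ := ∫ t in Ioi (0 : ℝ), nuIntegrand m n t

/-- `g` is real-analytic at every point of `J` and agrees there with the function `f`, which is
given on `D`. -/
def IsAnalyticContinuationOn (f : ℝ → ℝ) (D J : Set ℝ) (g : ℝ → ℝ) : Prop :=
  AnalyticOnNhd ℝ g J ∧ EqOn g f (D ∩ J)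

/-- `I` is the maximal (that is, largest) interval on which the function `f`, given on `D`, is
real-analytic after extension: `I` is an open interval containing `D` to which `f` extends
analytically, and every interval that meets the interior of `D` and on which `f` has an analytic
continuation is contained in `I`. -/
structure IsMaximalIntervalOfAnalyticity (f : ℝ → ℝ) (D I : Set ℝ) : Prop where
  isOpen : IsOpen I
  ordConnected : I.OrdConnected
  subset : D ⊆ I
  exists_continuation : ∃ g, IsAnalyticContinuationOn f D I g
  maximal : ∀ J : Set ℝ, J.OrdConnected → (J ∩ interior D).Nonempty →
    (∃ g, IsAnalyticContinuationOn f D J g) → J ⊆ I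

/-- On the interior of the domain `1 - tⁿ` is positive. -/
theorem one_sub_pow_pos {n : ℕ} (hn : 1 < n) {t : ℝ} (h1 : t < 1) (h2 : Even n → -1 < t) :
    0 < 1 - t ^ n := by
  rcases Nat.even_or_odd n with he | ho
  · have : |t| < 1 := abs_lt.2 ⟨h2 he, h1⟩
    have h := pow_lt_one₀ (abs_nonneg t) this (by omega : n ≠ 0)
    rw [he.pow_abs] at h
    linarith
  · have := ho.strictMono_pow h1
    simp only [one_pow] at this
    linarith

/-- The integral defining `F_{p,n}` converges on the whole domain. -/
theorem genF_intervalIntegrable {p : ℝ} (hp : 1 < p) {n : ℕ} (hn : 1 < n) {y : ℝ}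
    (hy : y ∈ genFDomain n) :
    IntervalIntegrable (fun t : ℝ => 1 / (1 - t ^ n) ^ (1 / p)) volume 0 y := by
  have hp0 : 0 < p := by linarith
  have hmeas : Measurable (fun t : ℝ => 1 / (1 - t ^ n) ^ (1 / p)) := by fun_prop
  have key : IntervalIntegrable (fun t : ℝ => 1 / (1 - t ^ n) ^ (1 / p)) volume 0 1 := by
    have h0 : IntervalIntegrable (fun t : ℝ => (1 - t) ^ (-(1 / p))) volume 0 1 := by
      have hr : -1 < -(1 / p) := by
        have : 1 / p < 1 := by rw [div_lt_one hp0]; exact hp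
        linarith
      have := (intervalIntegral.intervalIntegrable_rpow' (a := 1) (b := 0) hr).comp_sub_left 1
      simpa using this
    refine h0.mono_fun hmeas.aestronglyMeasurable ?_
    rw [uIoc_of_le zero_le_one]
    refine (ae_restrict_iff' measurableSet_Ioc).2 (ae_of_all _ fun t ht => ?_)
    have h1 : 0 ≤ 1 - t := by linarith [ht.2]
    have hle : 1 - t ≤ 1 - t ^ n := by
      have := pow_le_of_le_one ht.1.le ht.2 (by omega : n ≠ 0)
      linarith
    have h2 : 0 ≤ 1 - t ^ n := h1.trans hle
    beta_reduce
    rw [Real.norm_of_nonneg (by positivity), Real.norm_of_nonneg (by positivity),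
      Real.rpow_neg h1, one_div]
    rcases h1.eq_or_lt with h | h
    · have : t = 1 := by linarith
      subst this
      simp
    · gcongr
  rcases le_total 0 y with h0 | h0
  · refine key.mono_set ?_
    rw [uIcc_of_le h0, uIcc_of_le zero_le_one]
    exact Icc_subset_Icc_right hy.1
  · rcases Nat.even_or_odd n with he | ho
    · have h := (key.comp_sub_left 0)
      simp only [zero_sub, he.neg_pow, sub_zero] at h
      refine h.mono_set ?_
      rw [uIcc_of_ge h0, uIcc_of_ge (by norm_num : (-1 : ℝ) ≤ 0)]
      exact Icc_subset_Icc_left (hy.2 he)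
    · refine ContinuousOn.intervalIntegrable ?_
      rw [uIcc_of_ge h0]
      refine continuousOn_const.div (ContinuousOn.rpow_const (by fun_prop) ?_) ?_
      · intro t _; right; positivity
      · intro t ht
        have hpos := one_sub_pow_pos hn (t := t) (by linarith [ht.2])
          (fun h => absurd h (Nat.not_even_iff_odd.2 ho))
        exact (Real.rpow_pos_of_pos hpos _).ne'

/-- `F_{p,n}` is strictly increasing on its domain, so that it has an inverse there. -/
theorem genF_strictMonoOn {p : ℝ} (hp : 1 < p) {n : ℕ} (hn : 1 < n) :
    StrictMonoOn (genF p n) (genFDomain n) := by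
  intro a ha b hb hab
  have hia := genF_intervalIntegrable hp hn ha
  have hib := genF_intervalIntegrable hp hn hb
  have hsub := intervalIntegral.integral_interval_sub_left hib hia
  have hpos : 0 < ∫ t in a..b, 1 / (1 - t ^ n) ^ (1 / p) := by
    refine intervalIntegral.intervalIntegral_pos_of_pos_on (hia.symm.trans hib) ?_ hab
    intro t ht
    have := one_sub_pow_pos hn (t := t) (ht.2.trans_le hb.1)
      (fun h => (ha.2 h).trans_lt ht.1)
    exact one_div_pos.2 (Real.rpow_pos_of_pos this _)
  unfold genF
  linarith

end

/-!
# Real-analytic continuation of the generalized sine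

Let `m = p'` and let `q` be the exponent with `q' = n`. With `S = sin_{p,n}` and
`C = (1 - Sⁿ)^{1/m}` one has `S' = C^{m-1}` and `C' = -(n/m) S^{n-1}`, so that `(S, C)` moves along
the curve `sⁿ + cᵐ = 1`. The curve is regular; the only obstruction to continuing `S` is that the
point may run off to infinity in finite time. When `m` and `n` are both even the curve is
compact and the motion is periodic; otherwise the time to infinity is `ν(m,n)` when counted from
`s = 0` towards `s = -∞`, and `μ(m,n)` when counted from `s = 1` towards `s = ∞`.

No differential equation is used. In the interior of its domain `sin_{p,n}` is analytic
(`analyticAt_genSin`) as the inverse of `F_{p,n}`, which is analytic with non-vanishing derivative.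
At `π_{p,n}/2`, where the derivative of `F_{p,n}` is infinite, the curve is parametrized by `c`
instead. The substitution `tⁿ + uᵐ = 1` gives the duality
`F_{p,n}(y) + (m/n) F_{q,m}((1 - yⁿ)^{1/m}) = π_{p,n}/2` (`genF_add_dual`), that is
`sin_{p,n} x = (1 - sin_{q,m}((n/m)(π_{p,n}/2 - x))ᵐ)^{1/n}` for `0 ≤ x ≤ π_{p,n}/2`, and the
right-hand side `genSinBranch` is analytic across `π_{p,n}/2`.

If `m` is even, the right-hand side is symmetric about `π_{p,n}/2`, so the reflection of `sin_{p,n}`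
continues it, once if `n` is odd and periodically if `n` is even (`analyticAt_genSinPeriodic`). If
`m` is odd, the right-hand side increases to `∞` at `π_{p,n}/2 + (m/n) ν(n,m)`, which is
`π_{p,n}/2 + μ(m,n)` by the substitution `tⁿ = 1 + uᵐ`
(`integrableOn_muIntegrand_and_genNu_eq`). On the left, `sin_{p,n}` is odd if `n` is even and tends
to `-∞` at `-ν(m,n)` if `n` is odd. Outside the periodic case the extension thus blows up at both
ends of the interval, and by the identity theorem no interval on which there is a continuation
contains such an end (`isMaximalIntervalOfAnalyticity_Ioo`).
-/

open Filter Topology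

/-! ### Analyticity of the integral and of its inverse -/

/-- The integrand of `F_{p,n}` has a local primitive that is real-analytic: take the real part of
a complex primitive, on a small disc, of the holomorphic function `(1 - zⁿ)^{-s}`. -/
theorem exists_hasDerivAt_analyticAt {s : ℝ} {n : ℕ} {y : ℝ} (hy : 0 < 1 - y ^ n) :
    ∃ G : ℝ → ℝ, AnalyticAt ℝ G y ∧
      ∀ᶠ t in 𝓝 y, HasDerivAt G (1 / (1 - t ^ n) ^ s) t := by
  have hopen : IsOpen {z : ℂ | 1 - z ^ n ∈ Complex.slitPlane} :=
    Complex.isOpen_slitPlane.preimage (by fun_prop)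
  have hmem : (y : ℂ) ∈ {z : ℂ | 1 - z ^ n ∈ Complex.slitPlane} := by
    have : (1 - (y : ℂ) ^ n) = ((1 - y ^ n : ℝ) : ℂ) := by push_cast; rfl
    change 1 - (y : ℂ) ^ n ∈ Complex.slitPlane
    rw [this]
    exact Complex.ofReal_mem_slitPlane.2 hy
  obtain ⟨r, hr, hball⟩ := Metric.isOpen_iff.1 hopen _ hmem
  have hdiff : DifferentiableOn ℂ (fun z : ℂ => (1 - z ^ n) ^ (-(s : ℂ)))
      (Metric.ball (y : ℂ) r) := by
    intro z hz
    have hb : DifferentiableAt ℂ (fun z : ℂ => 1 - z ^ n) z := by fun_prop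
    exact (hb.cpow (differentiableAt_const _) (hball hz)).differentiableWithinAt
  obtain ⟨G, hG⟩ := hdiff.isExactOn_ball
  have hGan : AnalyticAt ℂ G (y : ℂ) :=
    DifferentiableOn.analyticAt (s := Metric.ball (y : ℂ) r)
      (fun z hz => (hG z hz).differentiableAt.differentiableWithinAt)
      (Metric.ball_mem_nhds _ hr)
  refine ⟨fun t => (G t).re, hGan.re_ofReal, ?_⟩
  have h1 : ∀ᶠ t : ℝ in 𝓝 y, 0 < 1 - t ^ n :=
    (by fun_prop : Continuous fun t : ℝ => 1 - t ^ n).continuousAt.eventually (lt_mem_nhds hy)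
  filter_upwards [h1, Metric.ball_mem_nhds y hr] with t ht htr
  have hz : (t : ℂ) ∈ Metric.ball (y : ℂ) r := by
    rw [Metric.mem_ball, Complex.dist_eq, ← Complex.ofReal_sub, Complex.norm_real]
    exact htr
  have h := (hG t hz).real_of_complex
  convert h using 1
  have h2 : (1 - (t : ℂ) ^ n) = ((1 - t ^ n : ℝ) : ℂ) := by push_cast; rfl
  beta_reduce
  rw [h2, ← Complex.ofReal_neg, ← Complex.ofReal_cpow ht.le, Complex.ofReal_re,
    Real.rpow_neg ht.le, one_div]

theorem hasDerivAt_genF {p : ℝ} {n : ℕ} (hp : 1 < p) (hn : 1 < n) {y : ℝ}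
    (h1 : y < 1) (h2 : Even n → -1 < y) :
    HasDerivAt (genF p n) (1 / (1 - y ^ n) ^ (1 / p)) y := by
  have hpos := one_sub_pow_pos hn h1 h2
  refine intervalIntegral.integral_hasDerivAt_right
    (genF_intervalIntegrable hp hn ⟨h1.le, fun h => (h2 h).le⟩) ?_ ?_
  · exact (by fun_prop : Measurable (fun t : ℝ => 1 / (1 - t ^ n) ^ (1 / p))).stronglyMeasurable
      |>.stronglyMeasurableAtFilter
  · exact continuousAt_const.div
      ((by fun_prop : ContinuousAt (fun t : ℝ => 1 - t ^ n) y).rpow_const (Or.inl hpos.ne'))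
      (Real.rpow_pos_of_pos hpos _).ne'

theorem eventually_mem_interior {n : ℕ} {y : ℝ} (h1 : y < 1) (h2 : Even n → -1 < y) :
    ∀ᶠ t in 𝓝 y, t < 1 ∧ (Even n → -1 < t) := by
  refine (gt_mem_nhds h1).and ?_
  by_cases he : Even n
  · filter_upwards [lt_mem_nhds (h2 he)] with t ht _ using ht
  · exact Eventually.of_forall fun t h => absurd h he

theorem analyticAt_genF {p : ℝ} {n : ℕ} (hp : 1 < p) (hn : 1 < n) {y : ℝ}
    (h1 : y < 1) (h2 : Even n → -1 < y) :
    AnalyticAt ℝ (genF p n) y := by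
  obtain ⟨G, hGa, hGd⟩ := exists_hasDerivAt_analyticAt (s := 1 / p) (one_sub_pow_pos hn h1 h2)
  obtain ⟨r, hr, hb⟩ := Metric.eventually_nhds_iff_ball.1
    (hGd.and (eventually_mem_interior h1 h2))
  have hconst : ∀ t ∈ Metric.ball y r, genF p n t - G t = genF p n y - G y := by
    intro t ht
    refine (convex_ball y r).is_const_of_fderivWithin_eq_zero (𝕜 := ℝ)
      (f := fun t => genF p n t - G t) ?_ ?_ ht (Metric.mem_ball_self hr)
    · intro u hu
      exact ((hasDerivAt_genF hp hn (hb u hu).2.1 (hb u hu).2.2).sub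
        (hb u hu).1).differentiableAt.differentiableWithinAt
    · intro u hu
      have h := (hasDerivAt_genF hp hn (hb u hu).2.1 (hb u hu).2.2).sub (hb u hu).1
      rw [sub_self] at h
      have h' := h.hasFDerivAt.hasFDerivWithinAt (s := Metric.ball y r)
      have h'' := h'.fderivWithin (Metric.isOpen_ball.uniqueDiffWithinAt hu)
      refine Eq.trans h'' ?_
      ext; simp
  refine (hGa.add (analyticAt_const (v := genF p n y - G y))).congr ?_
  filter_upwards [Metric.ball_mem_nhds y hr] with t ht
  have := hconst t ht
  simp only [Pi.add_apply]
  linarith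

theorem genSin_genF {p : ℝ} {n : ℕ} (hp : 1 < p) (hn : 1 < n) {y : ℝ}
    (hy : y ∈ genFDomain n) : genSin p n (genF p n y) = y :=
  (genF_strictMonoOn hp hn).injOn.leftInvOn_invFunOn hy

theorem analyticAt_genSin_genF {p : ℝ} {n : ℕ} (hp : 1 < p) (hn : 1 < n) {y : ℝ}
    (h1 : y < 1) (h2 : Even n → -1 < y) :
    AnalyticAt ℝ (genSin p n) (genF p n y) := by
  have hd := hasDerivAt_genF hp hn h1 h2
  have hpos := one_sub_pow_pos hn h1 h2
  have ha := analyticAt_genF hp hn h1 h2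
  have hne : deriv (genF p n) y ≠ 0 := by
    rw [hd.deriv]
    exact (one_div_pos.2 (Real.rpow_pos_of_pos hpos _)).ne'
  rw [← analyticAt_comp_iff_of_deriv_ne_zero ha hne]
  refine analyticAt_id.congr ?_
  filter_upwards [eventually_mem_interior h1 h2] with t ht
  exact (genSin_genF hp hn ⟨ht.1.le, fun h => (ht.2 h).le⟩).symm

theorem continuousOn_genF {p : ℝ} {n : ℕ} (hp : 1 < p) (hn : 1 < n) :
    ContinuousOn (genF p n) (genFDomain n) := by
  intro y hy
  rcases hy.1.lt_or_eq with h | h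
  · by_cases h2 : Even n → -1 < y
    · exact (hasDerivAt_genF hp hn h h2).continuousAt.continuousWithinAt
    · push Not at h2
      have hy1 : y = -1 := le_antisymm h2.2 (hy.2 h2.1)
      have h1 : (1 : ℝ) ∈ genFDomain n := ⟨le_rfl, fun _ => by norm_num⟩
      have hs : genFDomain n ⊆ uIcc y 1 := by
        rw [uIcc_of_le hy.1, hy1]
        exact fun t ht => ⟨ht.2 h2.1, ht.1⟩
      refine (intervalIntegral.continuousOn_primitive_interval'
        ((genF_intervalIntegrable hp hn hy).symm.trans (genF_intervalIntegrable hp hn h1))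
        ?_ y left_mem_uIcc).mono hs
      rw [uIcc_of_le hy.1, hy1]
      norm_num
  · subst h
    refine ((intervalIntegral.continuousOn_primitive_interval'
      (genF_intervalIntegrable hp hn hy) left_mem_uIcc) 1 right_mem_uIcc).mono_of_mem_nhdsWithin ?_
    rw [uIcc_of_le zero_le_one]
    filter_upwards [self_mem_nhdsWithin, mem_nhdsWithin_of_mem_nhds (lt_mem_nhds one_pos)]
      with t ht ht0 using ⟨ht0.le, ht.1⟩

/-! ### The improper integrals -/

theorem integrableOn_nuIntegrand {m n : ℕ} (hm : 1 < m) (hn : 1 < n) (hmn : 2 < m ∨ 2 < n) :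
    IntegrableOn (nuIntegrand m n) (Ioi 0) := by
  have hm0 : (0 : ℝ) < m := by positivity
  have hs : 0 ≤ ((m : ℝ) - 1) / m := by
    have : (1 : ℝ) < m := by exact_mod_cast hm
    exact div_nonneg (by linarith) hm0.le
  have hcont : ContinuousOn (nuIntegrand m n) (Ici 0) := by
    intro t ht
    have hpos : 0 < 1 + t ^ n := by have := pow_nonneg (mem_Ici.1 ht) n; linarith
    exact (continuousAt_const.div
      ((by fun_prop : ContinuousAt (fun t : ℝ => 1 + t ^ n) t).rpow_const (Or.inl hpos.ne'))
      (Real.rpow_pos_of_pos hpos _).ne').continuousWithinAt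
  rw [← Ioc_union_Ioi_eq_Ioi zero_le_one]
  refine IntegrableOn.union ?_ ?_
  · exact ((hcont.mono Icc_subset_Ici_self).integrableOn_Icc (a := 0) (b := 1)).mono_set
      Ioc_subset_Icc_self
  -- Convergence at infinity means `n (m - 1) > m`, that is `(m - 1) (n - 1) > 1`.
  · have hexp : -((n : ℝ) * (((m : ℝ) - 1) / m)) < -1 := by
      rw [neg_lt_neg_iff, ← mul_div_assoc, lt_div_iff₀ hm0, one_mul]
      have hm' : (2 : ℝ) ≤ m := by exact_mod_cast hm
      have hn' : (2 : ℝ) ≤ n := by exact_mod_cast hn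
      rcases hmn with h | h
      · have : (3 : ℝ) ≤ m := by exact_mod_cast h
        nlinarith
      · have : (3 : ℝ) ≤ n := by exact_mod_cast h
        nlinarith
    have hmeas : AEStronglyMeasurable (nuIntegrand m n) (volume.restrict (Ioi 1)) :=
      (hcont.mono (Ioi_subset_Ici zero_le_one)).aestronglyMeasurable measurableSet_Ioi
    refine Integrable.mono' (integrableOn_Ioi_rpow_of_lt hexp one_pos) hmeas ?_
    refine (ae_restrict_iff' measurableSet_Ioi).2 (ae_of_all _ fun t ht => ?_)
    have ht0 : 0 < t := one_pos.trans (mem_Ioi.1 ht)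
    have hpos : 0 < t ^ n := pow_pos ht0 n
    rw [nuIntegrand, Real.norm_of_nonneg (by positivity), Real.rpow_neg ht0.le,
      Real.rpow_mul ht0.le, Real.rpow_natCast, one_div]
    gcongr
    linarith

/-- The substitution `tⁿ = 1 + uᵐ` turns `μ(m,n)` into `(m/n) ν(n,m)`. This matches the end point of
the right-hand extension of `sin_{p,n}` with that of the domain of `sin_{q,m}`. -/
theorem integrableOn_muIntegrand_and_genNu_eq {m n : ℕ} (hm : 1 < m) (hn : 1 < n)
    (hmn : 2 < m ∨ 2 < n) :
    IntegrableOn (muIntegrand m n) (Ioi 1) ∧ genNu n m = n / m * genMu m n := by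
  have hm0 : (0 : ℝ) < m := by positivity
  have hn0 : (0 : ℝ) < n := by positivity
  set f : ℝ → ℝ := fun u => (1 + u ^ m) ^ (1 / (n : ℝ))
  set f' : ℝ → ℝ := fun u => m * u ^ (m - 1) * (1 / (n : ℝ)) * (1 + u ^ m) ^ (1 / (n : ℝ) - 1)
  have hpos : ∀ u ∈ Ioi (0 : ℝ), 0 < 1 + u ^ m := fun u hu => by
    have := pow_pos (mem_Ioi.1 hu) m
    linarith
  have hfn : ∀ u ∈ Ioi (0 : ℝ), f u ^ n = 1 + u ^ m := fun u hu => by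
    rw [← Real.rpow_natCast, ← Real.rpow_mul (hpos u hu).le, one_div_mul_cancel hn0.ne',
      Real.rpow_one]
  have hder : ∀ u ∈ Ioi (0 : ℝ), HasDerivWithinAt f (f' u) (Ioi 0) u := fun u hu =>
    (((hasDerivAt_pow m u).const_add 1).rpow_const (Or.inl (hpos u hu).ne')).hasDerivWithinAt
  have hinj : InjOn f (Ioi 0) := by
    intro u hu v hv huv
    have h : u ^ m = v ^ m := by
      have h1 := hfn u hu
      rw [huv, hfn v hv] at h1
      linarith
    exact (pow_left_inj₀ (le_of_lt hu) (le_of_lt hv) (by omega)).1 h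
  have himg : f '' Ioi 0 = Ioi 1 := by
    ext t
    constructor
    · rintro ⟨u, hu, rfl⟩
      exact Real.one_lt_rpow (by have := pow_pos (mem_Ioi.1 hu) m; linarith) (by positivity)
    · intro ht
      have ht0 : 0 < t := one_pos.trans ht
      have h1 : 0 < t ^ n - 1 := by
        have := one_lt_pow₀ (mem_Ioi.1 ht) (by omega : n ≠ 0)
        linarith
      refine ⟨(t ^ n - 1) ^ (1 / (m : ℝ)), Real.rpow_pos_of_pos h1 _, ?_⟩
      have h2 : ((t ^ n - 1) ^ (1 / (m : ℝ))) ^ m = t ^ n - 1 := by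
        rw [← Real.rpow_natCast, ← Real.rpow_mul h1.le, one_div_mul_cancel hm0.ne', Real.rpow_one]
      simp only [f]
      rw [h2, add_sub_cancel, ← Real.rpow_natCast, ← Real.rpow_mul ht0.le,
        mul_one_div_cancel hn0.ne', Real.rpow_one]
  have hint : ∀ u ∈ Ioi (0 : ℝ), |f' u| • muIntegrand m n (f u) = m / n * nuIntegrand n m u := by
    intro u hu
    have hu0 : 0 < u := hu
    have hp := hpos u hu
    have h1 : 0 ≤ f' u := by positivity
    have h2 : (u ^ m) ^ (((m : ℝ) - 1) / m) = u ^ (m - 1) := by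
      rw [← Real.rpow_natCast, ← Real.rpow_mul hu0.le, mul_div_cancel₀ _ hm0.ne',
        ← Real.rpow_natCast, Nat.cast_sub hm.le, Nat.cast_one]
    have h3 : (1 + u ^ m) ^ (1 / (n : ℝ) - 1) = 1 / (1 + u ^ m) ^ (((n : ℝ) - 1) / n) := by
      rw [one_div ((1 + u ^ m) ^ _), ← Real.rpow_neg hp.le]
      congr 1
      field_simp
      ring
    rw [abs_of_nonneg h1, smul_eq_mul, muIntegrand, hfn u hu, add_sub_cancel_left, h2, nuIntegrand]
    simp only [f']
    rw [h3]
    have := pow_pos hu0 (m - 1)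
    field_simp
  have hnu := (integrableOn_nuIntegrand hn hm hmn.symm).const_mul ((m : ℝ) / n)
  constructor
  · rw [← himg, integrableOn_image_iff_integrableOn_abs_deriv_smul measurableSet_Ioi hder hinj]
    exact IntegrableOn.congr_fun hnu (fun u hu => (hint u hu).symm) measurableSet_Ioi
  · rw [genMu, ← himg, integral_image_eq_integral_abs_deriv_smul measurableSet_Ioi hder hinj,
      setIntegral_congr_fun measurableSet_Ioi hint, integral_const_mul, genNu]
    field_simp

/-! ### The domain of the generalized sine -/

theorem genF_zero (p : ℝ) (n : ℕ) : genF p n 0 = 0 := intervalIntegral.integral_same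

theorem genF_one (p : ℝ) (n : ℕ) : genF p n 1 = genPi p n / 2 := by
  rw [genPi]; ring

theorem genPi_pos {p : ℝ} {n : ℕ} (hp : 1 < p) (hn : 1 < n) : 0 < genPi p n := by
  have := genF_strictMonoOn hp hn (a := 0) (b := 1) ⟨zero_le_one, fun _ => by norm_num⟩
    ⟨le_rfl, fun _ => by norm_num⟩ one_pos
  rw [genF_zero, genF_one] at this
  linarith

theorem genF_neg {p : ℝ} {n : ℕ} (he : Even n) (y : ℝ) : genF p n (-y) = -genF p n y := by
  have h := intervalIntegral.integral_comp_neg (a := 0) (b := y)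
    (fun t : ℝ => 1 / (1 - t ^ n) ^ (1 / p))
  simp only [he.neg_pow, neg_zero] at h
  rw [genF, genF, intervalIntegral.integral_symm, h]

theorem genSinDomain_of_even {p : ℝ} {n : ℕ} (hp : 1 < p) (hn : 1 < n) (he : Even n) :
    genSinDomain p n = Icc (-(genPi p n / 2)) (genPi p n / 2) := by
  have hD : genFDomain n = Icc (-1) 1 := by
    ext y; simp [genFDomain, he, and_comm]
  have hc := continuousOn_genF hp hn
  have hmono := (genF_strictMonoOn hp hn).monotoneOn
  rw [hD] at hc hmono
  rw [genSinDomain, hD, ← genF_one, ← genF_neg he]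
  refine Subset.antisymm ?_ (intermediate_value_Icc (by norm_num) hc)
  rintro _ ⟨y, hy, rfl⟩
  exact ⟨hmono (by norm_num) hy hy.1, hmono hy (by norm_num) hy.2⟩

theorem genF_neg_eq {p : ℝ} {m n : ℕ} (hpm : 1 / p = ((m : ℝ) - 1) / m) (ho : Odd n) (y : ℝ) :
    genF p n (-y) = -∫ t in (0 : ℝ)..y, nuIntegrand m n t := by
  have h := intervalIntegral.integral_comp_neg (a := 0) (b := y)
    (fun t : ℝ => 1 / (1 - t ^ n) ^ (1 / p))
  simp only [ho.neg_pow, neg_zero, sub_neg_eq_add] at h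
  rw [genF, intervalIntegral.integral_symm, ← h, hpm]
  rfl

theorem tendsto_genF_atBot {p : ℝ} {m n : ℕ} (hm : 1 < m) (hn : 1 < n)
    (hpm : 1 / p = ((m : ℝ) - 1) / m) (ho : Odd n) :
    Tendsto (genF p n) atBot (𝓝 (-genNu m n)) := by
  have hn2 : 2 < n := by obtain ⟨k, rfl⟩ := ho; omega
  have h := (intervalIntegral_tendsto_integral_Ioi 0
    (integrableOn_nuIntegrand hm hn (Or.inr hn2)) tendsto_neg_atBot_atTop).neg
  refine h.congr fun y => ?_
  rw [← genF_neg_eq hpm ho, neg_neg]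

theorem neg_genNu_lt_genF {p : ℝ} {m n : ℕ} (hp : 1 < p) (hm : 1 < m) (hn : 1 < n)
    (hpm : 1 / p = ((m : ℝ) - 1) / m) (ho : Odd n) {y : ℝ} (hy : y ≤ 1) :
    -genNu m n < genF p n y := by
  have hno : ¬ Even n := Nat.not_even_iff_odd.2 ho
  have hmono := genF_strictMonoOn hp hn
  have h1 : y - 1 ∈ genFDomain n := ⟨by linarith, fun h => absurd h hno⟩
  refine lt_of_le_of_lt ?_ (hmono h1 ⟨hy, fun h => absurd h hno⟩ (by linarith))
  refine le_of_tendsto (tendsto_genF_atBot hm hn hpm ho) ?_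
  filter_upwards [eventually_le_atBot (y - 1)] with t ht
  exact hmono.monotoneOn ⟨ht.trans h1.1, fun h => absurd h hno⟩ h1 ht

theorem genSinDomain_of_odd {p : ℝ} {m n : ℕ} (hp : 1 < p) (hm : 1 < m) (hn : 1 < n)
    (hpm : 1 / p = ((m : ℝ) - 1) / m) (ho : Odd n) :
    genSinDomain p n = Ioc (-genNu m n) (genPi p n / 2) := by
  have hno : ¬ Even n := Nat.not_even_iff_odd.2 ho
  have hD : genFDomain n = Iic 1 := by
    ext y; simp [genFDomain, hno]
  have hc := continuousOn_genF hp hn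
  have hmono := (genF_strictMonoOn hp hn).monotoneOn
  rw [hD] at hc hmono
  rw [genSinDomain, hD, ← genF_one]
  refine Subset.antisymm ?_ ?_
  · rintro _ ⟨y, hy, rfl⟩
    exact ⟨neg_genNu_lt_genF hp hm hn hpm ho hy, hmono hy (mem_Iic.2 le_rfl) hy⟩
  · intro x hx
    obtain ⟨y, hy, hy1⟩ := (((tendsto_genF_atBot hm hn hpm ho).eventually
      (gt_mem_nhds hx.1)).and (eventually_le_atBot 1)).exists
    obtain ⟨z, hz, rfl⟩ := intermediate_value_Icc hy1 (hc.mono Icc_subset_Iic_self)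
      ⟨hy.le, hx.2⟩
    exact ⟨z, hz.2, rfl⟩

/-! ### Maximality from blow-up -/

/-- An analytic function `G` that is unbounded towards `b` cannot be continued analytically to `b`. -/
theorem not_analyticAt_of_tendsto_abs_atTop {g G : ℝ → ℝ} {U : Set ℝ} {b c : ℝ} {l : Filter ℝ}
    [l.NeBot] (hU : IsPreconnected U) (hg : AnalyticOnNhd ℝ g U) (hG : AnalyticOnNhd ℝ G U)
    (hc : c ∈ U) (hgG : ∃ᶠ z in 𝓝[≠] c, g z = G z) (hUl : U ∈ l) (hl : l ≤ 𝓝 b)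
    (hlim : Tendsto (fun x => |G x|) l atTop) : ¬ AnalyticAt ℝ g b := by
  intro hb
  have heq := hg.eqOn_of_preconnected_of_frequently_eq hG hU hc hgG
  have h1 : Tendsto (fun x => |G x|) l (𝓝 |g b|) := by
    refine (hb.continuousAt.abs.tendsto.mono_left hl).congr' ?_
    filter_upwards [hUl] with x hx
    rw [heq hx]
  exact not_tendsto_nhds_of_tendsto_atTop hlim _ h1

/-- If an analytic extension to `(a, b)` blows up at both ends, then `(a, b)` is the maximal
interval. -/
theorem isMaximalIntervalOfAnalyticity_Ioo {f G : ℝ → ℝ} {D : Set ℝ} {a b : ℝ}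
    (hD : D ⊆ Ioo a b) (hG : AnalyticOnNhd ℝ G (Ioo a b)) (hGf : EqOn G f D)
    (ha : Tendsto (fun x => |G x|) (𝓝[>] a) atTop)
    (hb : Tendsto (fun x => |G x|) (𝓝[<] b) atTop) :
    IsMaximalIntervalOfAnalyticity f D (Ioo a b) where
  isOpen := isOpen_Ioo
  ordConnected := ordConnected_Ioo
  subset := hD
  exists_continuation := ⟨G, hG, fun x hx => hGf hx.1⟩
  maximal := by
    rintro J hJ ⟨c, hcJ, hcD⟩ ⟨g, hg, hgf⟩ x hxJ
    have hcI := hD (interior_subset hcD)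
    have hDc : ∀ᶠ z in 𝓝 c, z ∈ D := mem_interior_iff_mem_nhds.1 hcD
    by_contra hx
    rcases le_or_gt x a with hxa | hxa
    · have hsub : Icc a c ⊆ J := fun y hy => hJ.out hxJ hcJ ⟨hxa.trans hy.1, hy.2⟩
      have hsubI : Ioc a c ⊆ Ioo a b := fun y hy => ⟨hy.1, hy.2.trans_lt hcI.2⟩
      refine not_analyticAt_of_tendsto_abs_atTop (isPreconnected_Ioc (a := a) (b := c))
        (hg.mono (Ioc_subset_Icc_self.trans hsub)) (hG.mono hsubI) ⟨hcI.1, le_rfl⟩ ?_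
        (Ioc_mem_nhdsGT hcI.1) nhdsWithin_le_nhds ha (hg a (hsub ⟨le_rfl, hcI.1.le⟩))
      have : ∀ᶠ z in 𝓝[<] c, g z = G z := by
        filter_upwards [nhdsWithin_le_nhds hDc, Ioo_mem_nhdsLT hcI.1] with z hzD hz
        rw [hgf ⟨hzD, hsub ⟨hz.1.le, hz.2.le⟩⟩, hGf hzD]
      exact this.frequently.filter_mono (nhdsWithin_mono _ fun z hz => ne_of_lt hz)
    · have hxb : b ≤ x := not_lt.1 fun h => hx ⟨hxa, h⟩
      have hsub : Icc c b ⊆ J := fun y hy => hJ.out hcJ hxJ ⟨hy.1, hy.2.trans hxb⟩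
      have hsubI : Ico c b ⊆ Ioo a b := fun y hy => ⟨hcI.1.trans_le hy.1, hy.2⟩
      refine not_analyticAt_of_tendsto_abs_atTop (isPreconnected_Ico (a := c) (b := b))
        (hg.mono (Ico_subset_Icc_self.trans hsub)) (hG.mono hsubI) ⟨le_rfl, hcI.2⟩ ?_
        (Ico_mem_nhdsLT hcI.2) nhdsWithin_le_nhds hb (hg b (hsub ⟨hcI.2.le, le_rfl⟩))
      have : ∀ᶠ z in 𝓝[>] c, g z = G z := by
        filter_upwards [nhdsWithin_le_nhds hDc, Ioo_mem_nhdsGT hcI.2] with z hzD hz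
        rw [hgf ⟨hzD, hsub ⟨hz.1.le, hz.2.le⟩⟩, hGf hzD]
      exact this.frequently.filter_mono (nhdsWithin_mono _ fun z hz => ne_of_gt hz)

/-! ### The generalized sine on its domain -/

theorem exists_genF_eq {p : ℝ} {n : ℕ} {x : ℝ} (hx : x ∈ genSinDomain p n)
    (h1 : x < genPi p n / 2) (h2 : Even n → -(genPi p n / 2) < x) :
    ∃ y, y < 1 ∧ (Even n → -1 < y) ∧ genF p n y = x := by
  obtain ⟨y, hy, rfl⟩ := hx
  refine ⟨y, hy.1.lt_of_ne ?_, fun he => (hy.2 he).lt_of_ne ?_, rfl⟩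
  · rintro rfl
    exact h1.ne (genF_one p n)
  · rintro rfl
    have := h2 he
    rw [genF_neg he, genF_one] at this
    exact lt_irrefl _ this

theorem analyticAt_genSin {p : ℝ} {n : ℕ} (hp : 1 < p) (hn : 1 < n) {x : ℝ}
    (hx : x ∈ genSinDomain p n) (h1 : x < genPi p n / 2) (h2 : Even n → -(genPi p n / 2) < x) :
    AnalyticAt ℝ (genSin p n) x := by
  obtain ⟨y, hy1, hy2, rfl⟩ := exists_genF_eq hx h1 h2
  exact analyticAt_genSin_genF hp hn hy1 hy2

theorem genSin_neg {p : ℝ} {n : ℕ} (hp : 1 < p) (hn : 1 < n) (he : Even n) {x : ℝ}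
    (hx : x ∈ genSinDomain p n) : genSin p n (-x) = -genSin p n x := by
  obtain ⟨y, hy, rfl⟩ := hx
  have hy' : -y ∈ genFDomain n :=
    ⟨by linarith [hy.2 he], fun _ => by linarith [hy.1]⟩
  rw [← genF_neg he, genSin_genF hp hn hy, genSin_genF hp hn hy']

theorem tendsto_genSin_atBot {p : ℝ} {m n : ℕ} (hp : 1 < p) (hm : 1 < m) (hn : 1 < n)
    (hpm : 1 / p = ((m : ℝ) - 1) / m) (ho : Odd n) :
    Tendsto (genSin p n) (𝓝[>] (-genNu m n)) atBot := by
  refine tendsto_atBot.2 fun M => ?_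
  have hno : ¬ Even n := Nat.not_even_iff_odd.2 ho
  have hM : min M 1 ∈ genFDomain n := ⟨min_le_right _ _, fun h => absurd h hno⟩
  filter_upwards [Ioo_mem_nhdsGT (neg_genNu_lt_genF hp hm hn hpm ho hM.1)] with x hx
  have hxD : x ∈ genSinDomain p n := by
    rw [genSinDomain_of_odd hp hm hn hpm ho, ← genF_one]
    exact ⟨hx.1, hx.2.le.trans ((genF_strictMonoOn hp hn).monotoneOn hM
      ⟨le_rfl, fun h => absurd h hno⟩ hM.1)⟩
  obtain ⟨y, hy, rfl⟩ := hxD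
  rw [genSin_genF hp hn hy]
  exact (((genF_strictMonoOn hp hn).lt_iff_lt hy hM).1 hx.2).le.trans (min_le_left _ _)

/-! ### Duality and the branch through the right end point -/

/-- Duality between `F_{p,n}` and `F_{q,m}`, where `p, m` and `q, n` are conjugate: the substitution
`tⁿ + uᵐ = 1` turns the integral of `(1 - tⁿ)^{-(m-1)/m}` over `[y, 1]` into `m/n` times the
integral of `(1 - uᵐ)^{-(n-1)/n}` over `[0, (1 - yⁿ)^{1/m}]`. -/
theorem genF_add_dual {p q : ℝ} {m n : ℕ} (hp : 1 < p) (hq : 1 < q) (hm : 1 < m) (hn : 1 < n)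
    (hpm : 1 / p = ((m : ℝ) - 1) / m) (hqn : 1 / q = ((n : ℝ) - 1) / n) {y : ℝ}
    (hy : y ∈ Icc (0 : ℝ) 1) :
    genF p n y + m / n * genF q m ((1 - y ^ n) ^ (1 / (m : ℝ))) = genPi p n / 2 := by
  have hm0 : (0 : ℝ) < m := by positivity
  have hn0 : (0 : ℝ) < n := by positivity
  set f : ℝ → ℝ := fun y => genF p n y + m / n * genF q m ((1 - y ^ n) ^ (1 / (m : ℝ)))
  have hf1 : f 1 = genPi p n / 2 := by
    simp only [f]
    rw [one_pow, sub_self, Real.zero_rpow (by positivity), genF_zero, mul_zero, add_zero, genF_one]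
  have hpow : ∀ t ∈ Icc (0 : ℝ) 1, 0 ≤ 1 - t ^ n ∧ 1 - t ^ n ≤ 1 := fun t ht =>
    ⟨by linarith [pow_le_one₀ (n := n) ht.1 ht.2], by linarith [pow_nonneg ht.1 n]⟩
  have hcont : ContinuousOn f (Icc 0 1) := by
    refine ((continuousOn_genF hp hn).mono fun t ht => ⟨ht.2, fun _ => by linarith [ht.1]⟩).add
      (continuousOn_const.mul ((continuousOn_genF hq hm).comp ?_ ?_))
    · exact (by fun_prop : Continuous fun t : ℝ => 1 - t ^ n).continuousOn.rpow_const
        fun t _ => Or.inr (by positivity)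
    · intro t ht
      obtain ⟨h0, h1⟩ := hpow t ht
      exact ⟨Real.rpow_le_one h0 h1 (by positivity),
        fun _ => by linarith [Real.rpow_nonneg h0 (1 / (m : ℝ))]⟩
  have hder : ∀ t ∈ Ioo (0 : ℝ) 1, HasDerivAt f 0 t := by
    intro t ht
    have ht0 := ht.1
    have htn : 0 < t ^ n := pow_pos ht0 n
    have h0 : 0 < 1 - t ^ n := by linarith [pow_lt_one₀ ht0.le ht.2 (by omega : n ≠ 0)]
    have h1 : 1 - t ^ n < 1 := by linarith
    set c := (1 - t ^ n) ^ (1 / (m : ℝ))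
    have hc0 : 0 < c := Real.rpow_pos_of_pos h0 _
    have hc1 : c < 1 := Real.rpow_lt_one h0.le h1 (by positivity)
    have hcm : c ^ m = 1 - t ^ n := by
      rw [← Real.rpow_natCast, ← Real.rpow_mul h0.le, one_div_mul_cancel hm0.ne', Real.rpow_one]
    have hdc : HasDerivAt (fun t : ℝ => (1 - t ^ n) ^ (1 / (m : ℝ)))
        (-(n * t ^ (n - 1)) * (1 / (m : ℝ)) * (1 - t ^ n) ^ (1 / (m : ℝ) - 1)) t :=
      ((hasDerivAt_pow n t).const_sub 1).rpow_const (Or.inl h0.ne')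
    have hd := (hasDerivAt_genF hp hn ht.2 fun _ => by linarith).add
      (((hasDerivAt_genF hq hm hc1 fun _ => by linarith).comp t hdc).const_mul ((m : ℝ) / n))
    refine hd.congr_deriv ?_
    have e1 : (t ^ n) ^ (((n : ℝ) - 1) / n) = t ^ (n - 1) := by
      rw [← Real.rpow_natCast, ← Real.rpow_mul ht0.le, mul_div_cancel₀ _ hn0.ne',
        ← Real.rpow_natCast, Nat.cast_sub hn.le, Nat.cast_one]
    have e2 : (1 - t ^ n) ^ (1 / (m : ℝ) - 1) = 1 / (1 - t ^ n) ^ (((m : ℝ) - 1) / m) := by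
      rw [one_div ((1 - t ^ n) ^ _), ← Real.rpow_neg h0.le]
      congr 1
      field_simp
      ring
    rw [hcm, sub_sub_cancel, hqn, hpm, e1, e2]
    have := pow_pos ht0 (n - 1)
    have := Real.rpow_pos_of_pos h0 (((m : ℝ) - 1) / m)
    field_simp
    ring
  rcases hy.2.eq_or_lt with rfl | hy1
  · exact hf1
  · obtain ⟨c, -, hc⟩ := exists_hasDerivAt_eq_slope f (fun _ => 0) hy1
      (hcont.mono (Icc_subset_Icc_left hy.1)) fun t ht => hder t ⟨hy.1.trans_lt ht.1, ht.2⟩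
    have h2 : f 1 - f y = 0 := by
      rcases div_eq_zero_iff.1 hc.symm with h | h
      · exact h
      · linarith
    linarith

/-- The quarter periods are related by the duality at `y = 0`. -/
theorem genPi_dual {p q : ℝ} {m n : ℕ} (hp : 1 < p) (hq : 1 < q) (hm : 1 < m) (hn : 1 < n)
    (hpm : 1 / p = ((m : ℝ) - 1) / m) (hqn : 1 / q = ((n : ℝ) - 1) / n) :
    n / m * genPi p n = genPi q m := by
  have h := genF_add_dual hp hq hm hn hpm hqn (y := 0) (by norm_num)
  rw [zero_pow (by omega), sub_zero, Real.one_rpow, genF_zero, genF_one] at h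
  have hm0 : (0 : ℝ) < m := by positivity
  have hn0 : (0 : ℝ) < n := by positivity
  field_simp at h ⊢
  linarith

/-- The function `(1 - cᵐ)^{1/n}` with `c = sin_{q,m}((n/m)(π_{p,n}/2 - x))`, the generalized cosine
of `x`. It describes `sin_{p,n}` on both sides of `π_{p,n}/2`. -/
noncomputable def genSinBranch (p q : ℝ) (m n : ℕ) (x : ℝ) : ℝ :=
  (1 - genSin q m (n / m * (genPi p n / 2 - x)) ^ m) ^ (1 / (n : ℝ))

/-- On `[0, π_{p,n}/2]` the branch is the generalized sine itself; this is the duality written for the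
inverse functions. -/
theorem genSin_eq_genSinBranch {p q : ℝ} {m n : ℕ} (hp : 1 < p) (hq : 1 < q) (hm : 1 < m)
    (hn : 1 < n) (hpm : 1 / p = ((m : ℝ) - 1) / m) (hqn : 1 / q = ((n : ℝ) - 1) / n) {x : ℝ}
    (hx : x ∈ Icc 0 (genPi p n / 2)) : genSin p n x = genSinBranch p q m n x := by
  have hm0 : (0 : ℝ) < m := by positivity
  have hn0 : (0 : ℝ) < n := by positivity
  have hc : ContinuousOn (genF p n) (Icc 0 1) := (continuousOn_genF hp hn).mono
    fun t ht => ⟨ht.2, fun _ => by linarith [ht.1]⟩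
  obtain ⟨y, hy, rfl⟩ := intermediate_value_Icc zero_le_one hc
    (show x ∈ Icc (genF p n 0) (genF p n 1) by rwa [genF_zero, genF_one])
  have h0 : 0 ≤ 1 - y ^ n := by linarith [pow_le_one₀ (n := n) hy.1 hy.2]
  have h1 : 1 - y ^ n ≤ 1 := by linarith [pow_nonneg hy.1 n]
  have hdual := genF_add_dual hp hq hm hn hpm hqn hy
  have harg : n / m * (genPi p n / 2 - genF p n y) =
      genF q m ((1 - y ^ n) ^ (1 / (m : ℝ))) := by
    rw [← hdual]
    field_simp
    ring
  have hcD : (1 - y ^ n) ^ (1 / (m : ℝ)) ∈ genFDomain m :=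
    ⟨Real.rpow_le_one h0 h1 (by positivity),
      fun _ => by linarith [Real.rpow_nonneg h0 (1 / (m : ℝ))]⟩
  rw [genSin_genF hp hn ⟨hy.2, fun _ => by linarith [hy.1]⟩, genSinBranch, harg,
    genSin_genF hq hm hcD, ← Real.rpow_natCast _ m, ← Real.rpow_mul h0,
    one_div_mul_cancel hm0.ne', Real.rpow_one, sub_sub_cancel, ← Real.rpow_natCast,
    ← Real.rpow_mul hy.1, mul_one_div_cancel hn0.ne', Real.rpow_one]

/-- The branch is analytic wherever `sin_{q,m}` is evaluated in the interior of its domain, in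
particular at `x = π_{p,n}/2`. -/
theorem analyticAt_genSinBranch {p q : ℝ} {m n : ℕ} (hp : 1 < p) (hq : 1 < q) (hm : 1 < m)
    (hn : 1 < n) (hpm : 1 / p = ((m : ℝ) - 1) / m) (hqn : 1 / q = ((n : ℝ) - 1) / n) {x : ℝ}
    (hx : n / m * (genPi p n / 2 - x) ∈ genSinDomain q m) (h0 : 0 < x)
    (h1 : Even m → x < genPi p n) : AnalyticAt ℝ (genSinBranch p q m n) x := by
  have hmn : 0 < (n : ℝ) / m := by positivity
  have hdual := genPi_dual hp hq hm hn hpm hqn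
  have hlt : n / m * (genPi p n / 2 - x) < genPi q m / 2 := by
    rw [← hdual]
    nlinarith
  have hgt : Even m → -(genPi q m / 2) < n / m * (genPi p n / 2 - x) := fun he => by
    rw [← hdual]
    nlinarith [h1 he]
  have han : AnalyticAt ℝ (fun x => genSin q m (n / m * (genPi p n / 2 - x))) x :=
    (analyticAt_genSin hq hm hx hlt hgt).fun_comp
      (g := genSin q m) (f := fun x => n / m * (genPi p n / 2 - x)) (by fun_prop)
  obtain ⟨y, hy1, hy2, hyx⟩ := exists_genF_eq hx hlt hgt
  have hne : 1 - genSin q m (n / m * (genPi p n / 2 - x)) ^ m ≠ 0 := by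
    rw [← hyx, genSin_genF hq hm ⟨hy1.le, fun h => (hy2 h).le⟩]
    exact (one_sub_pow_pos hm hy1 hy2).ne'
  have hcd := ((analyticAt_const.sub (han.pow m)).contDiffAt (n := ⊤)).rpow_const_of_ne
    (p := 1 / (n : ℝ)) hne
  rwa [← contDiffWithinAt_univ, contDiffWithinAt_omega_iff_analyticWithinAt,
    analyticWithinAt_univ] at hcd

/-! ### Continuation past the right end point, for odd exponent -/

/-- The generalized sine continued to the right of `π_{p,n}/2` by `genSinBranch`. It is meant for odd
`m`, when the continuation grows beyond `1`. -/
noncomputable def genSinRight (p q : ℝ) (m n : ℕ) (x : ℝ) : ℝ :=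
  if x < genPi p n / 2 then genSin p n x else genSinBranch p q m n x

theorem eqOn_genSinRight {p q : ℝ} {m n : ℕ} (hp : 1 < p) (hq : 1 < q) (hm : 1 < m) (hn : 1 < n)
    (hpm : 1 / p = ((m : ℝ) - 1) / m) (hqn : 1 / q = ((n : ℝ) - 1) / n) :
    EqOn (genSinRight p q m n) (genSin p n) (Iic (genPi p n / 2)) := by
  intro x hx
  rcases (mem_Iic.1 hx).lt_or_eq with h | h
  · exact if_pos h
  · have := genPi_pos hp hn
    rw [genSinRight, if_neg h.not_lt, genSin_eq_genSinBranch hp hq hm hn hpm hqn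
      ⟨by linarith, h.le⟩]

/-- For odd `m`, the domain of `sin_{q,m}` reaches far enough to the left for `genSinBranch` to be
defined up to `π_{p,n}/2 + μ(m,n)`. -/
theorem mem_genSinDomain_dual {p q : ℝ} {m n : ℕ} (hp : 1 < p) (hq : 1 < q) (hm : 1 < m)
    (hn : 1 < n) (hpm : 1 / p = ((m : ℝ) - 1) / m) (hqn : 1 / q = ((n : ℝ) - 1) / n)
    (ho : Odd m) {x : ℝ} (h0 : 0 ≤ x) (h1 : x < genPi p n / 2 + genMu m n) :
    n / m * (genPi p n / 2 - x) ∈ genSinDomain q m := by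
  have hm0 : (0 : ℝ) < m := by positivity
  have hn0 : (0 : ℝ) < n := by positivity
  have hm2 : 2 < m := by obtain ⟨k, rfl⟩ := ho; omega
  have hnu := (integrableOn_muIntegrand_and_genNu_eq hm hn (Or.inl hm2)).2
  have hdual := genPi_dual hp hq hm hn hpm hqn
  rw [genSinDomain_of_odd hq hn hm hqn ho, ← hdual]
  have hmn : 0 < (n : ℝ) / m := by positivity
  rw [hnu]
  constructor <;> nlinarith

theorem analyticAt_genSinRight {p q : ℝ} {m n : ℕ} (hp : 1 < p) (hq : 1 < q) (hm : 1 < m)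
    (hn : 1 < n) (hpm : 1 / p = ((m : ℝ) - 1) / m) (hqn : 1 / q = ((n : ℝ) - 1) / n)
    (ho : Odd m) {x : ℝ} (hx : x < genPi p n / 2 → x ∈ genSinDomain p n)
    (h1 : Even n → -(genPi p n / 2) < x) (h2 : x < genPi p n / 2 + genMu m n) :
    AnalyticAt ℝ (genSinRight p q m n) x := by
  have hpi := genPi_pos hp hn
  rcases lt_or_ge x (genPi p n / 2) with h | h
  · refine (analyticAt_genSin hp hn (hx h) h h1).congr ?_
    filter_upwards [gt_mem_nhds h] with t ht using (if_pos ht).symm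
  · have h0 : 0 < x := by linarith
    refine (analyticAt_genSinBranch hp hq hm hn hpm hqn
      (mem_genSinDomain_dual hp hq hm hn hpm hqn ho h0.le h2) h0
      fun he => absurd he (Nat.not_even_iff_odd.2 ho)).congr ?_
    filter_upwards [lt_mem_nhds h0] with t ht
    rcases lt_or_ge t (genPi p n / 2) with h' | h'
    · rw [genSinRight, if_pos h', genSin_eq_genSinBranch hp hq hm hn hpm hqn ⟨ht.le, h'.le⟩]
    · rw [genSinRight, if_neg h'.not_gt]

theorem genMu_pos {q : ℝ} {m n : ℕ} (hq : 1 < q) (hm : 1 < m) (hn : 1 < n)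
    (hqn : 1 / q = ((n : ℝ) - 1) / n) (ho : Odd m) : 0 < genMu m n := by
  have hm2 : 2 < m := by obtain ⟨k, rfl⟩ := ho; omega
  have h := neg_genNu_lt_genF hq hn hm hqn ho zero_le_one
  rw [genF_zero, (integrableOn_muIntegrand_and_genNu_eq hm hn (Or.inl hm2)).2] at h
  have hmn : 0 < (n : ℝ) / m := by positivity
  exact (mul_pos_iff_of_pos_left hmn).1 (by linarith)

theorem tendsto_genSinRight {p q : ℝ} {m n : ℕ} (hq : 1 < q) (hm : 1 < m)
    (hn : 1 < n) (hqn : 1 / q = ((n : ℝ) - 1) / n) (ho : Odd m) :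
    Tendsto (genSinRight p q m n) (𝓝[<] (genPi p n / 2 + genMu m n)) atTop := by
  have hm0 : (0 : ℝ) < m := by positivity
  have hn0 : (0 : ℝ) < n := by positivity
  have hm2 : 2 < m := by obtain ⟨k, rfl⟩ := ho; omega
  have hnu := (integrableOn_muIntegrand_and_genNu_eq hm hn (Or.inl hm2)).2
  have hmn : 0 < (n : ℝ) / m := by positivity
  have hmu0 := genMu_pos hq hm hn hqn ho
  have harg : Tendsto (fun x => n / m * (genPi p n / 2 - x))
      (𝓝[<] (genPi p n / 2 + genMu m n)) (𝓝[>] (-genNu n m)) := by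
    refine tendsto_nhdsWithin_iff.2 ⟨?_, ?_⟩
    · have hc : Continuous fun x => (n : ℝ) / m * (genPi p n / 2 - x) := by fun_prop
      have := (hc.tendsto (genPi p n / 2 + genMu m n)).mono_left
        (nhdsWithin_le_nhds (s := Iio (genPi p n / 2 + genMu m n)))
      convert this using 2
      rw [hnu]
      ring
    · filter_upwards [self_mem_nhdsWithin] with x hx
      have := mem_Iio.1 hx
      rw [mem_Ioi, hnu]
      nlinarith
  have h1 := (tendsto_pow_atTop (α := ℝ) (by omega : m ≠ 0)).comp
    (tendsto_neg_atBot_atTop.comp ((tendsto_genSin_atBot hq hn hm hqn ho).comp harg))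
  have h2 := (tendsto_rpow_atTop (y := 1 / (n : ℝ)) (by positivity)).comp
    (tendsto_atTop_add_const_left _ 1 h1)
  refine h2.congr' ?_
  filter_upwards [Ioo_mem_nhdsLT (show genPi p n / 2 < genPi p n / 2 + genMu m n by linarith)]
    with x hx
  rw [genSinRight, if_neg hx.1.not_gt, genSinBranch, sub_eq_add_neg, ← ho.neg_pow]
  rfl

/-! ### Reflection about the right end point, for even exponent -/

/-- For even `m`, the even reflection of `sin_{p,n}` about `π_{p,n}/2` is given by the branch, since
`sin_{q,m}` is odd and enters through an even power. So the reflection is analytic there. -/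
theorem genSin_reflect_eq_genSinBranch {p q : ℝ} {m n : ℕ} (hp : 1 < p) (hq : 1 < q) (hm : 1 < m)
    (hn : 1 < n) (hpm : 1 / p = ((m : ℝ) - 1) / m) (hqn : 1 / q = ((n : ℝ) - 1) / n)
    (he : Even m) {x : ℝ} (hx : x ∈ Icc 0 (genPi p n)) :
    genSin p n (genPi p n / 2 - |x - genPi p n / 2|) = genSinBranch p q m n x := by
  have hmn : 0 < (n : ℝ) / m := by positivity
  have hdual := genPi_dual hp hq hm hn hpm hqn
  have habs : |x - genPi p n / 2| ≤ genPi p n / 2 :=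
    abs_le.2 ⟨by linarith [hx.1], by linarith [hx.2]⟩
  rw [genSin_eq_genSinBranch hp hq hm hn hpm hqn
    ⟨by linarith, by linarith [abs_nonneg (x - genPi p n / 2)]⟩, genSinBranch, genSinBranch,
    sub_sub_cancel]
  congr 2
  rcases abs_choice (x - genPi p n / 2) with h | h
  · have hD : n / m * (x - genPi p n / 2) ∈ genSinDomain q m := by
      rw [genSinDomain_of_even hq hm he, ← hdual]
      constructor <;> nlinarith [hx.1, hx.2]
    rw [h, show n / m * (genPi p n / 2 - x) = -(n / m * (x - genPi p n / 2)) by ring,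
      genSin_neg hq hm he hD, he.neg_pow]
  · rw [h, neg_sub]

theorem analyticAt_genSinBranch_half {p q : ℝ} {m n : ℕ} (hp : 1 < p) (hq : 1 < q) (hm : 1 < m)
    (hn : 1 < n) (hpm : 1 / p = ((m : ℝ) - 1) / m) (hqn : 1 / q = ((n : ℝ) - 1) / n) :
    AnalyticAt ℝ (genSinBranch p q m n) (genPi p n / 2) := by
  have hpi := genPi_pos hp hn
  refine analyticAt_genSinBranch hp hq hm hn hpm hqn ?_ (by linarith) fun _ => by linarith
  rw [sub_self, mul_zero]
  exact ⟨0, ⟨zero_le_one, fun _ => by norm_num⟩, genF_zero q m⟩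

/-! ### The periodic extension -/

/-- The generalized sine of a triangle wave of period `2π_{p,n}`, which is written as a rescaled
`arcsin (sin x)`. It is meant for even `n`. -/
noncomputable def genSinPeriodic (p : ℝ) (n : ℕ) (x : ℝ) : ℝ :=
  genSin p n (genPi p n / Real.pi * Real.arcsin (Real.sin (Real.pi * x / genPi p n)))

theorem genSinPeriodic_eq {p : ℝ} {n : ℕ} (hp : 1 < p) (hn : 1 < n) {x : ℝ}
    (hx : x ∈ Icc (-(genPi p n / 2)) (genPi p n / 2)) : genSinPeriodic p n x = genSin p n x := by
  have hP := genPi_pos hp hn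
  have hpi := Real.pi_pos
  rw [genSinPeriodic, Real.arcsin_sin]
  · congr 1
    field_simp
  · rw [le_div_iff₀ hP]
    nlinarith [hx.1]
  · rw [div_le_iff₀ hP]
    nlinarith [hx.2]

theorem genSinPeriodic_antiperiodic {p : ℝ} {n : ℕ} (hp : 1 < p) (hn : 1 < n) (he : Even n) :
    Function.Antiperiodic (genSinPeriodic p n) (genPi p n) := by
  intro x
  have hP := genPi_pos hp hn
  have hpi := Real.pi_pos
  rw [genSinPeriodic, genSinPeriodic, mul_add, add_div, mul_div_cancel_right₀ _ hP.ne',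
    Real.sin_add_pi, Real.arcsin_neg, mul_neg, genSin_neg hp hn he]
  rw [genSinDomain_of_even hp hn he]
  have h1 := Real.neg_pi_div_two_le_arcsin (Real.sin (Real.pi * x / genPi p n))
  have h2 := Real.arcsin_le_pi_div_two (Real.sin (Real.pi * x / genPi p n))
  rw [div_mul_eq_mul_div]
  constructor
  · rw [le_div_iff₀ hpi]
    nlinarith
  · rw [div_le_iff₀ hpi]
    nlinarith

theorem analyticAt_genSinPeriodic {p q : ℝ} {m n : ℕ} (hp : 1 < p) (hq : 1 < q) (hm : 1 < m)
    (hn : 1 < n) (hpm : 1 / p = ((m : ℝ) - 1) / m) (hqn : 1 / q = ((n : ℝ) - 1) / n)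
    (hme : Even m) (hne : Even n) (x : ℝ) : AnalyticAt ℝ (genSinPeriodic p n) x := by
  have hP := genPi_pos hp hn
  have hanti := genSinPeriodic_antiperiodic hp hn hne
  have hper : Function.Periodic (fun x => AnalyticAt ℝ (genSinPeriodic p n) x) (genPi p n) := by
    intro x
    refine propext ⟨fun h => ?_, fun h => ?_⟩
    · refine (AnalyticAt.fun_comp (f := fun y => y + genPi p n) h (by fun_prop)).neg.congr
        (Eventually.of_forall fun y => ?_)
      simp [hanti y]
    · refine (AnalyticAt.fun_comp (f := fun y => y - genPi p n) (x := x + genPi p n)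
        (by simpa using h) (by fun_prop)).neg.congr (Eventually.of_forall fun y => ?_)
      simp [hanti.sub_eq y]
  -- By antiperiodicity it suffices to treat the half-period `(-π_{p,n}/2, π_{p,n}/2]`.
  obtain ⟨y, hy, hxy⟩ := hper.exists_mem_Ioc hP x (-(genPi p n / 2))
  rw [hxy]
  have hy2 : y ≤ genPi p n / 2 := by linarith [hy.2]
  rcases hy2.lt_or_eq with h | rfl
  · refine (analyticAt_genSin hp hn ?_ h fun _ => hy.1).congr ?_
    · rw [genSinDomain_of_even hp hn hne]
      exact ⟨hy.1.le, h.le⟩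
    · filter_upwards [Icc_mem_nhds hy.1 h] with t ht
      exact (genSinPeriodic_eq hp hn ht).symm
  · refine (analyticAt_genSinBranch_half hp hq hm hn hpm hqn).congr ?_
    filter_upwards [Icc_mem_nhds (show 0 < genPi p n / 2 by linarith)
      (show genPi p n / 2 < genPi p n by linarith)] with t ht
    rw [← genSin_reflect_eq_genSinBranch hp hq hm hn hpm hqn hme ht]
    rcases le_total t (genPi p n / 2) with h | h
    · rw [abs_of_nonpos (by linarith), genSinPeriodic_eq hp hn ⟨by linarith [ht.1], h⟩]
      congr 1
      ring
    · have h1 : genSinPeriodic p n (genPi p n - t) = genSinPeriodic p n t := by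
        rw [genSinPeriodic, genSinPeriodic, mul_sub, sub_div, mul_div_cancel_right₀ _ hP.ne',
          Real.sin_pi_sub]
      rw [abs_of_nonneg (by linarith), ← h1,
        genSinPeriodic_eq hp hn ⟨by linarith [ht.2], by linarith⟩]
      congr 1
      ring

/-! ### The maximal intervals -/

theorem isMaximal_and_periodic_of_even_even {p q : ℝ} {m n : ℕ} (hp : 1 < p) (hq : 1 < q)
    (hm : 1 < m) (hn : 1 < n) (hpm : 1 / p = ((m : ℝ) - 1) / m)
    (hqn : 1 / q = ((n : ℝ) - 1) / n) (hme : Even m) (hne : Even n) :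
    IsMaximalIntervalOfAnalyticity (genSin p n) (genSinDomain p n) univ ∧
      ∀ g : ℝ → ℝ, IsAnalyticContinuationOn (genSin p n) (genSinDomain p n) univ g →
        Function.Periodic g (2 * genPi p n) := by
  have hP := genPi_pos hp hn
  have hD := genSinDomain_of_even hp hn hne
  have han : AnalyticOnNhd ℝ (genSinPeriodic p n) univ := fun x _ =>
    analyticAt_genSinPeriodic hp hq hm hn hpm hqn hme hne x
  have heq : EqOn (genSinPeriodic p n) (genSin p n) (genSinDomain p n) := fun x hx =>
    genSinPeriodic_eq hp hn (hD ▸ hx)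
  refine ⟨⟨isOpen_univ, ordConnected_univ, subset_univ _,
    ⟨_, han, heq.mono inter_subset_left⟩, fun J _ _ _ => subset_univ J⟩, ?_⟩
  rintro g ⟨hg, hgs⟩
  have hgG : g = genSinPeriodic p n := by
    refine hg.eq_of_eventuallyEq han (z₀ := 0) ?_
    filter_upwards [Icc_mem_nhds (show -(genPi p n / 2) < 0 by linarith)
      (show 0 < genPi p n / 2 by linarith)] with t ht
    rw [← hD] at ht
    rw [hgs ⟨ht, mem_univ t⟩, heq ht]
  rw [hgG]
  exact (genSinPeriodic_antiperiodic hp hn hne).periodic_two_mul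

theorem isMaximal_of_even_odd {p q : ℝ} {m n : ℕ} (hp : 1 < p) (hq : 1 < q)
    (hm : 1 < m) (hn : 1 < n) (hpm : 1 / p = ((m : ℝ) - 1) / m)
    (hqn : 1 / q = ((n : ℝ) - 1) / n) (hme : Even m) (hno : Odd n) :
    IsMaximalIntervalOfAnalyticity (genSin p n) (genSinDomain p n)
      (Ioo (-genNu m n) (genPi p n + genNu m n)) := by
  have hP := genPi_pos hp hn
  have hD := genSinDomain_of_odd hp hm hn hpm hno
  have hnu : 0 < genNu m n := by
    have := neg_genNu_lt_genF hp hm hn hpm hno zero_le_one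
    rw [genF_zero] at this
    linarith
  have hlim := tendsto_abs_atBot_atTop.comp (tendsto_genSin_atBot hp hm hn hpm hno)
  -- The reflection of `sin_{p,n}` about `π_{p,n}/2`.
  set G : ℝ → ℝ := fun x => genSin p n (genPi p n / 2 - |x - genPi p n / 2|)
  have hGl : ∀ x ≤ genPi p n / 2, G x = genSin p n x := fun x hx => by
    simp only [G]
    rw [abs_of_nonpos (by linarith)]
    congr 1
    ring
  have hGr : ∀ x ≥ genPi p n / 2, G x = genSin p n (genPi p n - x) := fun x hx => by
    simp only [G]
    rw [abs_of_nonneg (by linarith)]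
    congr 1
    ring
  have hS : ∀ x ∈ Ioo (-genNu m n) (genPi p n / 2), AnalyticAt ℝ (genSin p n) x := fun x hx =>
    analyticAt_genSin hp hn (hD ▸ Ioo_subset_Ioc_self hx) hx.2
      fun h => absurd h (Nat.not_even_iff_odd.2 hno)
  refine isMaximalIntervalOfAnalyticity_Ioo (G := G) ?_ ?_ ?_ ?_ ?_
  · rw [hD]
    exact fun x hx => ⟨hx.1, by linarith [hx.2]⟩
  · intro x hx
    rcases lt_trichotomy x (genPi p n / 2) with h | rfl | h
    · refine (hS x ⟨hx.1, h⟩).congr ?_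
      filter_upwards [gt_mem_nhds h] with t ht using (hGl t (le_of_lt ht)).symm
    · refine (analyticAt_genSinBranch_half hp hq hm hn hpm hqn).congr ?_
      filter_upwards [Icc_mem_nhds (show 0 < genPi p n / 2 by linarith)
        (show genPi p n / 2 < genPi p n by linarith)] with t ht
      exact (genSin_reflect_eq_genSinBranch hp hq hm hn hpm hqn hme ht).symm
    · refine (AnalyticAt.fun_comp (f := fun y => genPi p n - y)
        (hS (genPi p n - x) ⟨by linarith [hx.2], by linarith⟩) (by fun_prop)).congr ?_
      filter_upwards [lt_mem_nhds h] with t ht using (hGr t (le_of_lt ht)).symm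
  · rw [hD]
    exact fun x hx => hGl x hx.2
  · refine hlim.congr' ?_
    filter_upwards [Ioo_mem_nhdsGT (show -genNu m n < genPi p n / 2 by linarith)] with x hx
    rw [hGl x hx.2.le]
    rfl
  · have harg : Tendsto (fun x => genPi p n - x) (𝓝[<] (genPi p n + genNu m n))
        (𝓝[>] (-genNu m n)) := by
      refine tendsto_nhdsWithin_iff.2 ⟨?_, ?_⟩
      · have hc : Continuous fun x => genPi p n - x := by fun_prop
        have := (hc.tendsto (genPi p n + genNu m n)).mono_left
          (nhdsWithin_le_nhds (s := Iio (genPi p n + genNu m n)))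
        simpa using this
      · filter_upwards [self_mem_nhdsWithin] with x hx
        have := mem_Iio.1 hx
        rw [mem_Ioi]
        linarith
    refine (hlim.comp harg).congr' ?_
    filter_upwards [Ioo_mem_nhdsLT (show genPi p n / 2 < genPi p n + genNu m n by linarith)]
      with x hx
    rw [hGr x hx.1.le]
    rfl

theorem isMaximal_of_odd_even {p q : ℝ} {m n : ℕ} (hp : 1 < p) (hq : 1 < q)
    (hm : 1 < m) (hn : 1 < n) (hpm : 1 / p = ((m : ℝ) - 1) / m)
    (hqn : 1 / q = ((n : ℝ) - 1) / n) (hmo : Odd m) (hne : Even n) :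
    IsMaximalIntervalOfAnalyticity (genSin p n) (genSinDomain p n)
      (Ioo (-(genPi p n / 2) - genMu m n) (genPi p n / 2 + genMu m n)) := by
  have hP := genPi_pos hp hn
  have hmu := genMu_pos hq hm hn hqn hmo
  have hD := genSinDomain_of_even hp hn hne
  have hlim := tendsto_abs_atTop_atTop.comp (tendsto_genSinRight (p := p) hq hm hn hqn hmo)
  have hR := eqOn_genSinRight hp hq hm hn hpm hqn
  -- The odd extension of the continuation to the right.
  set G : ℝ → ℝ := fun x => if x < 0 then -genSinRight p q m n (-x) else genSinRight p q m n x
  have hGl : ∀ x < 0, G x = -genSinRight p q m n (-x) := fun x hx => if_pos hx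
  have hGr : ∀ x ≥ 0, G x = genSinRight p q m n x := fun x hx => if_neg (not_lt.2 hx)
  have hGD : EqOn G (genSin p n) (genSinDomain p n) := by
    intro x hx
    have hx' := hx
    rw [hD] at hx'
    rcases lt_or_ge x 0 with h | h
    · rw [hGl x h, hR (mem_Iic.2 (by linarith [hx'.1])), genSin_neg hp hn hne hx, neg_neg]
    · rw [hGr x h, hR hx'.2]
  have han : ∀ x ∈ Ioo (-(genPi p n / 2)) (genPi p n / 2 + genMu m n),
      AnalyticAt ℝ (genSinRight p q m n) x := fun x hx =>
    analyticAt_genSinRight hp hq hm hn hpm hqn hmo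
      (fun h => by rw [hD]; exact ⟨hx.1.le, h.le⟩) (fun _ => hx.1) hx.2
  refine isMaximalIntervalOfAnalyticity_Ioo (G := G) ?_ ?_ hGD ?_ ?_
  · rw [hD]
    exact fun x hx => ⟨by linarith [hx.1], by linarith [hx.2]⟩
  · intro x hx
    rcases lt_trichotomy x 0 with h | rfl | h
    · refine (AnalyticAt.fun_comp (f := fun y => -y)
        (han (-x) ⟨by linarith, by linarith [hx.1]⟩) (by fun_prop)).neg.congr ?_
      filter_upwards [gt_mem_nhds h] with t ht using (hGl t ht).symm
    · refine (han 0 ⟨by linarith, by linarith⟩).congr ?_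
      filter_upwards [Icc_mem_nhds (show -(genPi p n / 2) < 0 by linarith)
        (show 0 < genPi p n / 2 by linarith)] with t ht
      rw [hR ht.2, hGD (by rwa [hD])]
    · refine (han x ⟨by linarith, hx.2⟩).congr ?_
      filter_upwards [lt_mem_nhds h] with t ht using (hGr t (le_of_lt ht)).symm
  · have harg : Tendsto (fun x : ℝ => -x) (𝓝[>] (-(genPi p n / 2) - genMu m n))
        (𝓝[<] (genPi p n / 2 + genMu m n)) := by
      have := tendsto_neg_nhdsGT (a := -(genPi p n / 2) - genMu m n)
      rwa [neg_sub', neg_neg, sub_neg_eq_add] at this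
    refine (hlim.comp harg).congr' ?_
    filter_upwards [Ioo_mem_nhdsGT (show -(genPi p n / 2) - genMu m n < 0 by linarith)]
      with x hx
    rw [hGl x hx.2, abs_neg]
    rfl
  · refine hlim.congr' ?_
    filter_upwards [Ioo_mem_nhdsLT (show 0 < genPi p n / 2 + genMu m n by linarith)] with x hx
    rw [hGr x hx.1.le]
    rfl

theorem isMaximal_of_odd_odd {p q : ℝ} {m n : ℕ} (hp : 1 < p) (hq : 1 < q)
    (hm : 1 < m) (hn : 1 < n) (hpm : 1 / p = ((m : ℝ) - 1) / m)
    (hqn : 1 / q = ((n : ℝ) - 1) / n) (hmo : Odd m) (hno : Odd n) :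
    IsMaximalIntervalOfAnalyticity (genSin p n) (genSinDomain p n)
      (Ioo (-genNu m n) (genPi p n / 2 + genMu m n)) := by
  have hmu := genMu_pos hq hm hn hqn hmo
  have hD := genSinDomain_of_odd hp hm hn hpm hno
  have hR := eqOn_genSinRight hp hq hm hn hpm hqn
  refine isMaximalIntervalOfAnalyticity_Ioo (G := genSinRight p q m n) ?_ ?_ ?_ ?_ ?_
  · rw [hD]
    exact fun x hx => ⟨hx.1, by linarith [hx.2]⟩
  · intro x hx
    exact analyticAt_genSinRight hp hq hm hn hpm hqn hmo
      (fun h => by rw [hD]; exact ⟨hx.1, h.le⟩)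
      (fun h => absurd h (Nat.not_even_iff_odd.2 hno)) hx.2
  · rw [hD]
    exact fun x hx => hR hx.2
  · refine (tendsto_abs_atBot_atTop.comp (tendsto_genSin_atBot hp hm hn hpm hno)).congr' ?_
    have hlt := neg_genNu_lt_genF hp hm hn hpm hno le_rfl
    rw [genF_one] at hlt
    filter_upwards [Ioo_mem_nhdsGT hlt] with x hx
    rw [hR hx.2.le]
    rfl
  · exact tendsto_abs_atTop_atTop.comp (tendsto_genSinRight hq hm hn hqn hmo)

theorem theorem2 (p : ℝ) (hp : 1 < p) (n : ℕ) (hn : 1 < n)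
    (m : ℕ) (hm : p.conjExponent = (m : ℝ)) :
    (Even m → Even n →
      IsMaximalIntervalOfAnalyticity (genSin p n) (genSinDomain p n) Set.univ ∧
      ∀ g : ℝ → ℝ, IsAnalyticContinuationOn (genSin p n) (genSinDomain p n) Set.univ g →
        Function.Periodic g (2 * genPi p n)) ∧
    (Even m → Odd n →
      MeasureTheory.IntegrableOn (nuIntegrand m n) (Set.Ioi 0) ∧
      IsMaximalIntervalOfAnalyticity (genSin p n) (genSinDomain p n)
        (Set.Ioo (-genNu m n) (genPi p n + genNu m n))) ∧
    (Odd m → Even n →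
      MeasureTheory.IntegrableOn (muIntegrand m n) (Set.Ioi 1) ∧
      IsMaximalIntervalOfAnalyticity (genSin p n) (genSinDomain p n)
        (Set.Ioo (-(genPi p n / 2) - genMu m n) (genPi p n / 2 + genMu m n))) ∧
    (Odd m → Odd n →
      MeasureTheory.IntegrableOn (nuIntegrand m n) (Set.Ioi 0) ∧
      MeasureTheory.IntegrableOn (muIntegrand m n) (Set.Ioi 1) ∧
      IsMaximalIntervalOfAnalyticity (genSin p n) (genSinDomain p n)
        (Set.Ioo (-genNu m n) (genPi p n / 2 + genMu m n))) := by
  have hp0 : 0 < p := by linarith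
  have hpm' : p / (p - 1) = m := hm
  have hpeq : p = m * (p - 1) := (div_eq_iff (by linarith)).1 hpm'
  have hm1' : (1 : ℝ) < m := by
    rw [← hpm', lt_div_iff₀ (by linarith)]
    linarith
  have hm1 : 1 < m := by exact_mod_cast hm1'
  have hn1 : (1 : ℝ) < n := by exact_mod_cast hn
  have hpm : 1 / p = ((m : ℝ) - 1) / m := by
    rw [div_eq_div_iff hp0.ne' (by linarith)]
    linarith
  -- `q` is the exponent whose conjugate exponent is `n`.
  obtain ⟨q, hq, hqn⟩ : ∃ q : ℝ, 1 < q ∧ 1 / q = ((n : ℝ) - 1) / n := by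
    refine ⟨n / (n - 1), ?_, one_div_div _ _⟩
    rw [lt_div_iff₀ (by linarith)]
    linarith
  have h3 : ∀ {k : ℕ}, 1 < k → Odd k → 2 < k := by
    rintro _ hk ⟨j, rfl⟩
    omega
  refine ⟨fun h h' => isMaximal_and_periodic_of_even_even hp hq hm1 hn hpm hqn h h',
    fun h h' => ⟨integrableOn_nuIntegrand hm1 hn (Or.inr (h3 hn h')),
      isMaximal_of_even_odd hp hq hm1 hn hpm hqn h h'⟩,
    fun h h' => ⟨(integrableOn_muIntegrand_and_genNu_eq hm1 hn (Or.inl (h3 hm1 h))).1,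
      isMaximal_of_odd_even hp hq hm1 hn hpm hqn h h'⟩,
    fun h h' => ⟨integrableOn_nuIntegrand hm1 hn (Or.inr (h3 hn h')),
      (integrableOn_muIntegrand_and_genNu_eq hm1 hn (Or.inl (h3 hm1 h))).1,
      isMaximal_of_odd_odd hp hq hm1 hn hpm hqn h h'⟩⟩
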